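/- Let $A$ (arcs, or resources) and $K$ (O/D pairs, or user groups) be finite sets, $K\neq\emptyset$, and for each $k\in K$ let $\mathcal S_k$ be a non-empty finite collection of non-empty subsets of $A$ (the paths, or strategies, of $k$). A cost function is a continuous, non-decreasing function $[0,\infty)\to[0,\infty)$. A game $\Gamma=(\tau,d)$ consists of cost functions $\tau=(\tau_a)_{a\in A}$ and demands $d=(d_k)_{k\in K}$, $d_k\ge 0$, such that the total demand $T(d)=\sum_k d_k$ is positive and $\tau_a(x)>0$ for all $a\in A$ and $x\in(0,T(d)]$. A flow is a family $f_{k,s}\ge 0$ ($k\in K$, $s\in\mathcal S_k$) with $\sum_{s\in\mathcal S_k}f_{k,s}=d_k$ for all $k$; it has the arc flows $f_a=\sum_k\sum_{s\in\mathcal S_k,\,a\in s}f_{k,s}$, the path costs $\tau_s(f)=\sum_{a\in s}\tau_a(f_a)$ and the total cost $C(\Gamma,f)=\sum_k\sum_{s\in\mathcal S_k}f_{k,s}\,\tau_s(f)$. A social optimum is a flow of minimum total cost; a Wardrop equilibrium is a flow such that $f_{k,s}>0$ implies $\tau_s(f)\le\tau_{s'}(f)$ for all $k\in K$ and $s,s'\in\mathcal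 S_k$. The price of anarchy $\rho(\Gamma)$ is the (worst) ratio of the total cost of a Wardrop equilibrium to that of a social optimum. For a vector $\tau$ of functions, the cost slice of $\tau$ is the set of all games $(\sigma,d)$ with $\sigma_a=\tau_a$ on $[0,T(d)]$ for all $a\in A$. A function $g$ is regularly varying with index $\beta$ if it is measurable and positive on some interval $[X,\infty)$ and $\lim_{T\to\infty}g(Tx)/g(T)=x^\beta$ for all $x>0$. (a) Let $\tau=(\tau_a)_{a\in A}$ be cost functions that are regularly varying with a common index $\beta>0$ and for which the limits $\lambda_{a,b}=\lim_{T\to\infty}\tau_a(T)/\tau_b(T)\in(0,\infty)$ exist for all $a,b\in A$. Then the cost slice of $\tau$ behaves well for growing demands, i.e., $\rho(\Gamma_n)\to 1$ for every sequence $(\Gamma_n)$ of games of the slice whose total demands tend to $\infty$. Moreover, for every $b\in A$ the deviation bound $$w(T)=\max_{a\in A,\;x\in[0,1]}\Big|\frac{\tau_a(Tx)}{\tau_b(T)}-\lambda_{a,b}\,x^\beta\Big|$$ tends to $0$ as $T\to\infty$, and $\rho(\Gamma)=1+O\big(\sqrt{w(T(d))}\big)$, i.e., there are constants $C,T_0>0$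 such that $|\rho(\Gamma)-1|\le C\sqrt{w(T(d))}$ for every game $\Gamma$ of the slice, with demand vector $d$, such that $T(d)\ge T_0$. (b) Let $\beta>0$, $\alpha\ge 0$ and $\zeta_a>0$ ($a\in A$) be constants and $\tau_a(x)=\zeta_a\,x^\beta\ln^\alpha(x+1)$. Then $\rho(\Gamma)=1+O\big(\sqrt{1/\ln(T(d)+1)}\big)$, i.e., there are constants $C,T_0>0$ such that $|\rho(\Gamma)-1|\le C\sqrt{1/\ln(T(d)+1)}$ for every game $\Gamma$ of the cost slice of $\tau$, with demand vector $d$, such that $T(d)\ge T_0$. -/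

import Mathlib

open Filter Topology

noncomputable section

/-- The combinatorial structure of a non-atomic congestion game: `A` is the set of resources
(arcs) and `K` the set of user groups (O/D pairs). Group `k` has a finite non-empty
collection of strategies (paths), each of which is a non-empty set of arcs. -/
structure CongestionStructure (A K : Type*) where
  strategies : K → Finset (Finset A)
  strategies_nonempty : ∀ k, (strategies k).Nonempty
  nonempty_of_mem : ∀ k, ∀ s ∈ strategies k, s.Nonempty

/-- A cost function: continuous, non-decreasing and non-negative on `[0, ∞)`. The values
at negative reals play no role. -/
structure IsCostFunction (g : ℝ → ℝ) : Prop where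
  continuousOn : ContinuousOn g (Set.Ici 0)
  monotoneOn : MonotoneOn g (Set.Ici 0)
  nonneg : ∀ x, 0 ≤ x → 0 ≤ g x

/-- A game with combinatorial structure `S`: a vector of cost functions and a demand vector,
such that the total demand `T` is positive and every cost function is positive on `(0, T]`. -/
structure CongestionGame {A K : Type*} [Fintype K] (S : CongestionStructure A K) where
  cost : A → ℝ → ℝ
  demand : K → ℝ
  isCostFunction : ∀ a, IsCostFunction (cost a)
  demand_nonneg : ∀ k, 0 ≤ demand k
  total_pos : 0 < ∑ k, demand k
  cost_pos : ∀ a x, 0 < x → x ≤ ∑ k, demand k → 0 < cost a x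

namespace CongestionGame

variable {A K : Type*} [Fintype K] [DecidableEq A] {S : CongestionStructure A K}

/-- The total demand `T(d)`. -/
def totalDemand (Γ : CongestionGame S) : ℝ := ∑ k, Γ.demand k

/-- `f k s` is the amount of the demand of group `k` that uses the strategy `s`
(only `s ∈ S.strategies k` is relevant). -/
def IsFlow (Γ : CongestionGame S) (f : K → Finset A → ℝ) : Prop :=
  (∀ k, ∀ s ∈ S.strategies k, 0 ≤ f k s) ∧
    ∀ k, ∑ s ∈ S.strategies k, f k s = Γ.demand k

/-- The flow value of the arc `a`. -/
def arcFlow (_Γ : CongestionGame S) (f : K → Finset A → ℝ) (a : A) : ℝ :=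
  ∑ k, ∑ s ∈ S.strategies k with a ∈ s, f k s

/-- The cost of the path `s` under the flow `f`. -/
def pathCost (Γ : CongestionGame S) (f : K → Finset A → ℝ) (s : Finset A) : ℝ :=
  ∑ a ∈ s, Γ.cost a (Γ.arcFlow f a)

/-- The total cost of all users under the flow `f`. -/
def totalCost (Γ : CongestionGame S) (f : K → Finset A → ℝ) : ℝ :=
  ∑ k, ∑ s ∈ S.strategies k, f k s * Γ.pathCost f s

/-- Social optimum: a flow of minimum total cost. -/
def IsSocialOptimum (Γ : CongestionGame S) (f : K → Finset A → ℝ) : Prop :=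
  Γ.IsFlow f ∧ ∀ g, Γ.IsFlow g → Γ.totalCost f ≤ Γ.totalCost g

/-- Wardrop equilibrium: every used path of a group is a cheapest path of that group. -/
def IsWardropEquilibrium (Γ : CongestionGame S) (f : K → Finset A → ℝ) : Prop :=
  Γ.IsFlow f ∧ ∀ k, ∀ s ∈ S.strategies k, ∀ s' ∈ S.strategies k,
    0 < f k s → Γ.pathCost f s ≤ Γ.pathCost f s'

/-- The price of anarchy: the worst ratio of the total cost of a Wardrop equilibrium to that
of a social optimum. -/
def priceOfAnarchy (Γ : CongestionGame S) : ℝ :=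
  sSup {r : ℝ | ∃ f g, Γ.IsWardropEquilibrium f ∧ Γ.IsSocialOptimum g ∧
    r = Γ.totalCost f / Γ.totalCost g}

end CongestionGame

/-- The cost slice of `τ`: all games whose cost functions agree with `τ` on `[0, T(d)]`. -/
def costSlice {A K : Type*} [Fintype K] (S : CongestionStructure A K) (τ : A → ℝ → ℝ) :
    Set (CongestionGame S) :=
  {Γ | ∀ a, ∀ x ∈ Set.Icc 0 Γ.totalDemand, Γ.cost a x = τ a x}

/-- The cost slice of `τ` behaves well for growing demands: the price of anarchy tends to 1
along every sequence of games of the slice whose total demand tends to infinity. -/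
def BehavesWellForGrowingDemands {A K : Type*} [Fintype K] [DecidableEq A]
    (S : CongestionStructure A K) (τ : A → ℝ → ℝ) : Prop :=
  ∀ Γ : ℕ → CongestionGame S, (∀ n, Γ n ∈ costSlice S τ) →
    Tendsto (fun n => (Γ n).totalDemand) atTop atTop →
    Tendsto (fun n => (Γ n).priceOfAnarchy) atTop (𝓝 1)

/-- `g` is regularly varying (at infinity) with index `β`: it is positive and measurable on
some `[X, ∞)`, and `g (T x) / g T → x ^ β` as `T → ∞` for every `x > 0`. -/
structure RegularlyVarying (g : ℝ → ℝ) (β : ℝ) : Prop where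
  eventually_pos_measurable :
    ∃ X : ℝ, (∀ x, X ≤ x → 0 < g x) ∧ Measurable (fun x : Set.Ici X => g x)
  tendsto : ∀ x : ℝ, 0 < x → Tendsto (fun T => g (T * x) / g T) atTop (𝓝 (x ^ β))

/-- The deviation bound
`w(T) = max_{a ∈ A, x ∈ [0,1]} |τ_a(T x) / τ_b(T) - lam_{a,b} x ^ β|`. -/
def deviationBound {A : Type*} (τ : A → ℝ → ℝ) (lam : A → A → ℝ) (β : ℝ) (b : A) (T : ℝ) : ℝ :=
  ⨆ p : A × Set.Icc (0 : ℝ) 1,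
    |τ p.1 (T * (p.2 : ℝ)) / τ b T - lam p.1 b * (p.2 : ℝ) ^ β|

end

/-! If every cost is a monomial `l a * x ^ β` of one common degree, the marginal social cost is `β +
1` times the cost, so equilibria are optimal. Games with large demand are perturbations of this
case: after rescaling arc flows by the total demand and costs by a normalizer, all costs lie
uniformly within some `w` of such monomials.

Quantitatively, the variational inequality for an equilibrium, transferred to the monomials with
error `O(w)`, combines with the convexity of `y ^ (β + 1)` to show that an equilibrium costs at most
`O(w)` more than any flow. Normalized total costs are bounded below, since some arc carries a fixed
share of the demand. Hence the price of anarchy is `1 + O(w)`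
(`exists_abs_priceOfAnarchy_sub_one_le`), which implies the square-root bounds because `w ≤ √w` for
`w ≤ 1`.

It remains to control `w`. For regularly varying costs, monotonicity upgrades pointwise to uniform
convergence. For logarithmic costs a direct estimate gives `w = O(1 / ln T)`. -/

namespace CongestionGame

/-! ### Flows, social optima and Wardrop equilibria -/

/-- A cost function, extended to the negative reals by its value at `0`. -/
lemma continuous_cost_max {A K : Type*} [Fintype K] {S : CongestionStructure A K}
    (Γ : CongestionGame S) (a : A) :
    Continuous fun t => Γ.cost a (max t 0) :=
  (Γ.isCostFunction a).continuousOn.comp_continuous (by fun_prop) fun t => le_max_right t 0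

/-- Moving an amount `ε` of group `k` from the path `s` to the path `s'`. -/
def shift {A K : Type*} [DecidableEq A] [DecidableEq K] (f : K → Finset A → ℝ) (k : K)
    (s s' : Finset A) (ε : ℝ) : K → Finset A → ℝ :=
  fun j r => f j r + ε * (if j = k ∧ r = s' then 1 else 0) - ε * (if j = k ∧ r = s then 1 else 0)

lemma sum_shift {A K : Type*} [DecidableEq A] [DecidableEq K] (f : K → Finset A → ℝ)
    (k j : K) (s s' : Finset A) (ε : ℝ)
    (B : Finset (Finset A)) :
    ∑ r ∈ B, shift f k s s' ε j r = ∑ r ∈ B, f j r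
      + ε * (if j = k ∧ s' ∈ B then 1 else 0) - ε * (if j = k ∧ s ∈ B then 1 else 0) := by
  simp only [shift, Finset.sum_add_distrib, Finset.sum_sub_distrib, ← Finset.mul_sum]
  by_cases h : j = k <;> simp [h]

section

variable {A K : Type*} [Fintype K] [DecidableEq A] {S : CongestionStructure A K}

lemma arcFlow_nonneg {Γ : CongestionGame S} {f : K → Finset A → ℝ} (hf : Γ.IsFlow f) (a : A) :
    0 ≤ Γ.arcFlow f a :=
  Finset.sum_nonneg fun k _ => Finset.sum_nonneg fun s hs =>
    hf.1 k s (Finset.mem_filter.1 hs).1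

lemma arcFlow_le {Γ : CongestionGame S} {f : K → Finset A → ℝ} (hf : Γ.IsFlow f) (a : A) :
    Γ.arcFlow f a ≤ Γ.totalDemand := by
  refine Finset.sum_le_sum fun k _ => ?_
  rw [← hf.2 k]
  exact Finset.sum_le_sum_of_subset_of_nonneg (Finset.filter_subset _ _)
    fun s hs _ => hf.1 k s hs

/-- Exchanging the summation over paths with the summation over arcs. -/
lemma sum_mul_sum_eq [Fintype A] (Γ : CongestionGame S) (g : K → Finset A → ℝ) (c : A → ℝ) :
    ∑ k, ∑ s ∈ S.strategies k, g k s * ∑ a ∈ s, c a = ∑ a, c a * Γ.arcFlow g a := by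
  simp only [arcFlow, Finset.mul_sum]
  rw [Finset.sum_comm]
  refine Finset.sum_congr rfl fun k _ => ?_
  simp only [Finset.sum_filter]
  rw [Finset.sum_comm]
  refine Finset.sum_congr rfl fun s _ => ?_
  rw [← Finset.sum_filter]
  exact Finset.sum_congr (by ext; simp) fun a _ => mul_comm _ _

lemma totalCost_eq [Fintype A] (Γ : CongestionGame S) (f : K → Finset A → ℝ) :
    Γ.totalCost f = ∑ a, Γ.cost a (Γ.arcFlow f a) * Γ.arcFlow f a :=
  Γ.sum_mul_sum_eq f _

/-- Strategies are non-empty, so each unit of demand uses at least one arc. -/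
lemma totalDemand_le_sum_arcFlow [Fintype A] {Γ : CongestionGame S} {f : K → Finset A → ℝ}
    (hf : Γ.IsFlow f) : Γ.totalDemand ≤ ∑ a, Γ.arcFlow f a := by
  have h := Γ.sum_mul_sum_eq f fun _ => 1
  simp only [one_mul] at h
  rw [← h]
  refine Finset.sum_le_sum fun k _ => ?_
  rw [← hf.2 k]
  refine Finset.sum_le_sum fun s hs => le_mul_of_one_le_right (hf.1 k s hs) ?_
  simpa using (S.nonempty_of_mem k s hs)

/-- The variational inequality satisfied by Wardrop equilibria. -/
lemma IsWardropEquilibrium.sum_cost_mul_le [Fintype A] {Γ : CongestionGame S}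
    {f g : K → Finset A → ℝ} (hf : Γ.IsWardropEquilibrium f) (hg : Γ.IsFlow g) :
    ∑ a, Γ.cost a (Γ.arcFlow f a) * Γ.arcFlow f a
      ≤ ∑ a, Γ.cost a (Γ.arcFlow f a) * Γ.arcFlow g a := by
  rw [← sum_mul_sum_eq, ← sum_mul_sum_eq]
  refine Finset.sum_le_sum fun k _ => ?_
  change ∑ s ∈ S.strategies k, f k s * Γ.pathCost f s
    ≤ ∑ s ∈ S.strategies k, g k s * Γ.pathCost f s
  obtain ⟨m, hm, hmin⟩ := Finset.exists_min_image _ (Γ.pathCost f) (S.strategies_nonempty k)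
  calc ∑ s ∈ S.strategies k, f k s * Γ.pathCost f s
      ≤ ∑ s ∈ S.strategies k, f k s * Γ.pathCost f m := by
        refine Finset.sum_le_sum fun s hs => ?_
        rcases (hf.1.1 k s hs).eq_or_lt with h | h
        · simp [← h]
        · exact mul_le_mul_of_nonneg_left (hf.2 k s hs m hm h) h.le
    _ = ∑ s ∈ S.strategies k, g k s * Γ.pathCost f m := by
        rw [← Finset.sum_mul, ← Finset.sum_mul, hf.1.2, hg.2]
    _ ≤ _ := Finset.sum_le_sum fun s hs =>
        mul_le_mul_of_nonneg_left (hmin s hs) (hg.1 k s hs)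

/-- The flows that vanish outside of the strategies. -/
def supportedFlows (Γ : CongestionGame S) : Set (K → Finset A → ℝ) :=
  {f | Γ.IsFlow f ∧ ∀ k, ∀ s ∉ S.strategies k, f k s = 0}

/-- `IsFlow` leaves the values off the strategies free, so the set of all flows need not be compact;
fixing these values at zero loses no arc flows. -/
lemma isCompact_supportedFlows (Γ : CongestionGame S) : IsCompact Γ.supportedFlows := by
  refine (isCompact_Icc (a := (0 : K → Finset A → ℝ)) (b := fun k _ => Γ.demand k)
    ).of_isClosed_subset ?_ ?_
  · simp only [supportedFlows, IsFlow, Set.ofPred_and, Set.ofPred_forall]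
    refine ((isClosed_iInter fun k => isClosed_iInter fun s => isClosed_iInter fun _ => ?_).inter
      (isClosed_iInter fun k => ?_)).inter
      (isClosed_iInter fun k => isClosed_iInter fun s => isClosed_iInter fun _ => ?_)
    · exact isClosed_le continuous_const (by fun_prop)
    · exact isClosed_eq (by fun_prop) continuous_const
    · exact isClosed_eq (by fun_prop) continuous_const
  · rintro f ⟨hf, h0⟩
    refine ⟨fun k s => ?_, fun k s => ?_⟩ <;> by_cases hs : s ∈ S.strategies k
    · exact hf.1 k s hs
    · simp [h0 k s hs]
    · exact (Finset.single_le_sum (fun s hs => hf.1 k s hs) hs).trans_eq (hf.2 k)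
    · simpa [h0 k s hs] using Γ.demand_nonneg k

lemma supportedFlows_nonempty (Γ : CongestionGame S) : Γ.supportedFlows.Nonempty := by
  choose p hp using S.strategies_nonempty
  refine ⟨fun k s => if s = p k then Γ.demand k else 0, ⟨fun k s _ => ?_, fun k => ?_⟩,
    fun k s hs => ?_⟩
  · dsimp only
    split_ifs
    exacts [Γ.demand_nonneg k, le_rfl]
  · simp [hp k]
  · exact if_neg fun (h : s = p k) => hs (h ▸ hp k)

/-- Every flow can be modified outside of the strategies to one that vanishes there. -/
lemma exists_supportedFlow {Γ : CongestionGame S} {g : K → Finset A → ℝ} (hg : Γ.IsFlow g) :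
    ∃ g' ∈ Γ.supportedFlows, Γ.arcFlow g' = Γ.arcFlow g := by
  refine ⟨fun k s => if s ∈ S.strategies k then g k s else 0, ⟨⟨fun k s hs => ?_, fun k => ?_⟩,
    fun k s hs => if_neg hs⟩, ?_⟩
  · simpa [hs] using hg.1 k s hs
  · rw [← hg.2 k]
    exact Finset.sum_congr rfl fun s hs => if_pos hs
  · funext a
    exact Finset.sum_congr rfl fun k _ => Finset.sum_congr rfl fun s hs =>
      if_pos (Finset.mem_filter.1 hs).1

lemma continuous_arcFlow (Γ : CongestionGame S) (a : A) :
    Continuous fun f => Γ.arcFlow f a := by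
  unfold arcFlow
  fun_prop

lemma exists_isSocialOptimum [Fintype A] (Γ : CongestionGame S) :
    ∃ f, Γ.IsSocialOptimum f := by
  have hc : Continuous fun f => ∑ a, Γ.cost a (max (Γ.arcFlow f a) 0) * Γ.arcFlow f a :=
    continuous_finsetSum _ fun a _ =>
      ((Γ.continuous_cost_max a).comp (Γ.continuous_arcFlow a)).mul (Γ.continuous_arcFlow a)
  obtain ⟨f, hf, hmin⟩ := Γ.isCompact_supportedFlows.exists_isMinOn Γ.supportedFlows_nonempty
    hc.continuousOn
  refine ⟨f, hf.1, fun g hg => ?_⟩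
  obtain ⟨g', hg', he⟩ := exists_supportedFlow hg
  have h := hmin hg'
  simp only [Set.mem_ofPred_eq, he] at h
  simpa only [totalCost_eq, max_eq_left (arcFlow_nonneg hf.1 _), max_eq_left (arcFlow_nonneg hg _)]
    using h

lemma arcFlow_shift [DecidableEq K] (Γ : CongestionGame S) (f : K → Finset A → ℝ) {k : K}
    {s s' : Finset A} (hs : s ∈ S.strategies k) (hs' : s' ∈ S.strategies k) (ε : ℝ) (a : A) :
    Γ.arcFlow (shift f k s s' ε) a
      = Γ.arcFlow f a + ε * ((if a ∈ s' then 1 else 0) - (if a ∈ s then 1 else 0)) := by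
  simp only [arcFlow, sum_shift, Finset.sum_add_distrib, Finset.sum_sub_distrib,
    ← Finset.mul_sum, Finset.mem_filter]
  have key : ∀ r ∈ S.strategies k,
      (∑ j, if j = k ∧ r ∈ S.strategies j ∧ a ∈ r then (1 : ℝ) else 0)
        = if a ∈ r then 1 else 0 := by
    intro r hr
    rw [Finset.sum_eq_single k]
    · simp [hr]
    · intro j _ hj
      simp [hj]
    · simp
  rw [key s hs, key s' hs']
  ring

lemma isFlow_shift [DecidableEq K] {Γ : CongestionGame S} {f : K → Finset A → ℝ}
    (hf : Γ.IsFlow f) {k : K} {s s' : Finset A} (hs : s ∈ S.strategies k)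
    (hs' : s' ∈ S.strategies k) {ε : ℝ} (h0 : 0 ≤ ε) (hε : ε ≤ f k s) :
    Γ.IsFlow (shift f k s s' ε) := by
  refine ⟨fun j r hr => ?_, fun j => ?_⟩
  · have h1 := hf.1 j r hr
    unfold shift
    by_cases h : j = k ∧ r = s
    · obtain ⟨rfl, rfl⟩ := h
      split_ifs <;> simp <;> linarith
    · rw [if_neg h]
      split_ifs <;> simp <;> linarith
  · rw [sum_shift, hf.2 j]
    by_cases h : j = k
    · subst h
      simp [hs, hs']
    · simp [h]

/-- A minimizer of the Beckmann potential, the sum of the integrals of the arc costs up to the arc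
flows, is an equilibrium: its derivative along a shift from `s` to `s'` is the difference of the
path costs. -/
lemma exists_isWardropEquilibrium [Fintype A] (Γ : CongestionGame S) :
    ∃ f, Γ.IsWardropEquilibrium f := by
  classical
  set P : A → ℝ → ℝ := fun a x => ∫ t in (0 : ℝ)..x, Γ.cost a (max t 0) with hP
  have hd : ∀ a x, HasDerivAt (P a) (Γ.cost a (max x 0)) x := fun a x =>
    (Γ.continuous_cost_max a).integral_hasStrictDerivAt 0 x |>.hasDerivAt
  have hc : Continuous fun f => ∑ a, P a (Γ.arcFlow f a) :=
    continuous_finsetSum _ fun a _ =>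
      (continuous_iff_continuousAt.2 fun x => (hd a x).continuousAt).comp (Γ.continuous_arcFlow a)
  obtain ⟨f, hf, hmin⟩ := Γ.isCompact_supportedFlows.exists_isMinOn Γ.supportedFlows_nonempty
    hc.continuousOn
  refine ⟨f, hf.1, fun k s hs s' hs' hpos => ?_⟩
  set δ : A → ℝ := fun a => (if a ∈ s' then 1 else 0) - (if a ∈ s then 1 else 0) with hδ
  have hder : HasDerivAt (fun ε : ℝ => ∑ a, P a (Γ.arcFlow f a + ε * δ a))
      (∑ a, Γ.cost a (Γ.arcFlow f a) * δ a) 0 := by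
    refine HasDerivAt.fun_sum fun a _ => ?_
    have h1 : HasDerivAt (fun ε : ℝ => Γ.arcFlow f a + ε * δ a) (δ a) 0 := by
      simpa using ((hasDerivAt_id (0 : ℝ)).mul_const (δ a)).const_add (Γ.arcFlow f a)
    have h2 := hd a (Γ.arcFlow f a + 0 * δ a)
    have h3 := h2.comp (0 : ℝ) h1
    rwa [zero_mul, add_zero, max_eq_left (arcFlow_nonneg hf.1 a)] at h3
  have hsum : ∑ a, Γ.cost a (Γ.arcFlow f a) * δ a = Γ.pathCost f s' - Γ.pathCost f s := by
    simp [hδ, mul_sub, pathCost, Finset.sum_sub_distrib]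
  have hnn : 0 ≤ ∑ a, Γ.cost a (Γ.arcFlow f a) * δ a := by
    -- Only shifts with `0 < ε ≤ f k s` are known to be feasible, so the right-hand slope is used.
    refine ge_of_tendsto hder.tendsto_slope_zero_right ?_
    filter_upwards [Ioc_mem_nhdsGT hpos] with ε hε
    obtain ⟨g, hg, he⟩ := exists_supportedFlow (isFlow_shift hf.1 hs hs' hε.1.le hε.2)
    have h := hmin hg
    simp only [Set.mem_ofPred_eq, he, arcFlow_shift Γ f hs hs'] at h
    refine smul_nonneg (inv_nonneg.2 hε.1.le) ?_
    simpa [hδ] using h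
  linarith

/-- If the total costs of equilibria exceed those of all flows by at most a factor `1 + e`, then
so does the price of anarchy. -/
lemma abs_priceOfAnarchy_sub_one_le [Fintype A] (Γ : CongestionGame S) {e : ℝ}
    (hpos : ∀ g, Γ.IsFlow g → 0 < Γ.totalCost g)
    (h : ∀ f g, Γ.IsWardropEquilibrium f → Γ.IsFlow g →
      Γ.totalCost f ≤ (1 + e) * Γ.totalCost g) :
    |Γ.priceOfAnarchy - 1| ≤ e := by
  -- Existence matters: the supremum of an empty set would be the default value `0`.
  obtain ⟨f, hf⟩ := Γ.exists_isWardropEquilibrium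
  obtain ⟨g, hg⟩ := Γ.exists_isSocialOptimum
  set R : Set ℝ := {r : ℝ | ∃ f g, Γ.IsWardropEquilibrium f ∧ Γ.IsSocialOptimum g ∧
    r = Γ.totalCost f / Γ.totalCost g}
  have hub : ∀ r ∈ R, r ≤ 1 + e := by
    rintro r ⟨f, g, hf, hg, rfl⟩
    exact (div_le_iff₀ (hpos g hg.1)).2 (h f g hf hg.1)
  have hmem : Γ.totalCost f / Γ.totalCost g ∈ R := ⟨f, g, hf, hg, rfl⟩
  have h1 : 1 ≤ Γ.priceOfAnarchy :=
    ((one_le_div (hpos g hg.1)).2 (hg.2 f hf.1)).trans (le_csSup ⟨_, hub⟩ hmem)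
  have h2 : Γ.priceOfAnarchy ≤ 1 + e := csSup_le ⟨_, hmem⟩ hub
  rw [abs_of_nonneg (by linarith)]
  linarith

end

end CongestionGame

/-! ### Comparison with a game with monomial costs -/

/-- The tangent of the convex function `y ↦ y ^ (β + 1)` lies below its graph. -/
lemma rpow_add_one_sub_le {β x y : ℝ} (hβ : 0 < β) (hx : 0 ≤ x) (hy : 0 ≤ y) :
    x ^ β * x - y ^ β * y ≤ (β + 1) * (x ^ β * (x - y)) := by
  rcases hx.eq_or_lt with rfl | hx
  · rw [Real.zero_rpow hβ.ne']
    have := mul_nonneg (Real.rpow_nonneg hy β) hy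
    linarith
  -- Bernoulli's inequality for the ratio `y / x`, to be multiplied by `x ^ (β + 1)`.
  have hB := one_add_mul_self_le_rpow_one_add (s := y / x - 1) (p := β + 1)
    (by linarith [div_nonneg hy hx.le]) (by linarith)
  rw [add_sub_cancel, Real.div_rpow hy hx.le, Real.rpow_add_one' hy (by linarith),
    Real.rpow_add_one hx.ne', le_div_iff₀ (by positivity)] at hB
  have : (1 + (β + 1) * (y / x - 1)) * (x ^ β * x)
      = x ^ β * x + (β + 1) * (x ^ β * (y - x)) := by
    field_simp
  linarith

namespace CongestionGame

/-- The comparison of the price of anarchy with that of a limit game with monomial costs: if the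
normalized cost functions are uniformly within `w` of monomials of degree `β`, then the price of
anarchy is `1 + O(w)`. -/
theorem exists_abs_priceOfAnarchy_sub_one_le {A K : Type*} [Fintype A] [DecidableEq A] [Fintype K]
    [Nonempty A] (S : CongestionStructure A K) {β : ℝ} (hβ : 0 < β) {l : A → ℝ}
    (hl : ∀ a, 0 < l a) :
    ∃ C > 0, ∃ w₀ > 0, ∀ (Γ : CongestionGame S) (c w : ℝ), 0 < c → w ≤ w₀ →
      (∀ a, ∀ x ∈ Set.Icc (0 : ℝ) 1,
        |Γ.cost a (Γ.totalDemand * x) / c - l a * x ^ β| ≤ w) →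
      |Γ.priceOfAnarchy - 1| ≤ C * w := by
  obtain ⟨a₀, hmin⟩ := Finite.exists_min l
  set n : ℝ := (Fintype.card A : ℝ) with hn
  have hn0 : 0 < n := by simpa [hn] using Fintype.card_pos (α := A)
  set κ : ℝ := l a₀ * ((1 / n) ^ β * (1 / n)) with hκ
  have hκ0 : 0 < κ := by have := hl a₀; positivity
  -- `κ` bounds the monomial cost of any flow from below, and `w₀` makes the error `n * w` at most
  -- `κ / 2`. In `β + 3`, the summand `β + 1` comes from the variational inequality and `2` from the
  -- two total costs.
  refine ⟨2 * (β + 3) * n / κ, by positivity, κ / (2 * n), by positivity,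
    fun Γ c w hc hw h => ?_⟩
  set T := Γ.totalDemand with hT
  have hT0 : 0 < T := Γ.total_pos
  have hw0 : 0 ≤ w := (abs_nonneg _).trans (h a₀ 0 (by simp))
  have hnw : n * w ≤ κ / 2 := by
    calc n * w ≤ n * (κ / (2 * n)) := by gcongr
      _ = κ / 2 := by field_simp
  -- normalized quantities
  set X : (K → Finset A → ℝ) → A → ℝ := fun f a => Γ.arcFlow f a / T with hX
  set Z : (K → Finset A → ℝ) → A → ℝ := fun f a => Γ.cost a (Γ.arcFlow f a) / c with hZ
  have hX01 : ∀ f, Γ.IsFlow f → ∀ a, X f a ∈ Set.Icc (0 : ℝ) 1 := fun f hf a =>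
    ⟨div_nonneg (arcFlow_nonneg hf a) hT0.le, (div_le_one hT0).2 (arcFlow_le hf a)⟩
  have hZX : ∀ f, Γ.IsFlow f → ∀ a, |Z f a - l a * X f a ^ β| ≤ w := fun f hf a => by
    have := h a _ (hX01 f hf a)
    rwa [show T * X f a = Γ.arcFlow f a from mul_div_cancel₀ _ hT0.ne'] at this
  have hcost : ∀ f, Γ.totalCost f = T * c * ∑ a, Z f a * X f a := fun f => by
    rw [totalCost_eq, Finset.mul_sum]
    refine Finset.sum_congr rfl fun a _ => ?_
    simp only [hX, hZ]
    field_simp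
  -- Replacing costs by monomials costs at most `n * w` against any bounded test vector; it is
  -- applied to `X f` and to `X f - X g`.
  have hclose : ∀ f, Γ.IsFlow f → ∀ u : A → ℝ, (∀ a, |u a| ≤ 1) →
      |∑ a, Z f a * u a - ∑ a, l a * X f a ^ β * u a| ≤ n * w := by
    intro f hf u hu
    rw [← Finset.sum_sub_distrib]
    calc _ ≤ ∑ a, |Z f a * u a - l a * X f a ^ β * u a| := Finset.abs_sum_le_sum_abs _ _
      _ ≤ ∑ _a : A, w := Finset.sum_le_sum fun a _ => by
          rw [← sub_mul, abs_mul]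
          exact (mul_le_of_le_one_right (abs_nonneg _) (hu a)).trans (hZX f hf a)
      _ = n * w := by simp [hn]
  have hcloseX : ∀ f, Γ.IsFlow f →
      |∑ a, Z f a * X f a - ∑ a, l a * X f a ^ β * X f a| ≤ n * w := fun f hf =>
    hclose f hf _ fun a => by
      rw [abs_of_nonneg (hX01 f hf a).1]
      exact (hX01 f hf a).2
  have hlower : ∀ g, Γ.IsFlow g → κ ≤ ∑ a, l a * X g a ^ β * X g a := by
    intro g hg
    have hsum : ∑ _a : A, 1 / n ≤ ∑ a, X g a := by
      have h1 : ∑ _a : A, 1 / n = 1 := by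
        simp only [Finset.sum_const, Finset.card_univ, nsmul_eq_mul, ← hn]
        field_simp
      rw [h1, ← Finset.sum_div, one_le_div hT0]
      exact totalDemand_le_sum_arcFlow hg
    -- By pigeonhole some arc carries at least the fraction `1 / n` of the demand.
    obtain ⟨a, -, ha⟩ := Finset.exists_le_of_sum_le Finset.univ_nonempty hsum
    have hterm : ∀ a, 0 ≤ l a * X g a ^ β * X g a := fun a =>
      mul_nonneg (mul_nonneg (hl a).le (Real.rpow_nonneg (hX01 g hg a).1 _)) (hX01 g hg a).1
    refine le_trans ?_ (Finset.single_le_sum (fun a _ => hterm a) (Finset.mem_univ a))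
    have := (hX01 g hg a).1
    have := hmin a
    have := (hl a).le
    rw [hκ, mul_assoc]
    gcongr
  have hpos : ∀ g, Γ.IsFlow g → κ / 2 ≤ ∑ a, Z g a * X g a := fun g hg => by
    have h1 := abs_le.1 (hcloseX g hg)
    have h2 := hlower g hg
    linarith [h1.1]
  refine Γ.abs_priceOfAnarchy_sub_one_le (fun g hg => ?_) fun f g hf hg => ?_
  · rw [hcost]
    have := hpos g hg
    have : 0 < ∑ a, Z g a * X g a := by linarith
    positivity
  have hVI : ∑ a, Z f a * (X f a - X g a) ≤ 0 := by
    have h1 := hf.sum_cost_mul_le hg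
    have h2 : ∑ a, Z f a * (X f a - X g a)
        = (∑ a, Γ.cost a (Γ.arcFlow f a) * Γ.arcFlow f a
          - ∑ a, Γ.cost a (Γ.arcFlow f a) * Γ.arcFlow g a) / (c * T) := by
      rw [← Finset.sum_sub_distrib, Finset.sum_div]
      refine Finset.sum_congr rfl fun a _ => ?_
      simp only [hX, hZ]
      field_simp
    rw [h2]
    exact div_nonpos_of_nonpos_of_nonneg (by linarith) (by positivity)
  have hconv : ∑ a, l a * X f a ^ β * X f a - ∑ a, l a * X g a ^ β * X g a
      ≤ (β + 1) * ∑ a, l a * X f a ^ β * (X f a - X g a) := by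
    rw [← Finset.sum_sub_distrib, Finset.mul_sum]
    refine Finset.sum_le_sum fun a _ => ?_
    have := mul_le_mul_of_nonneg_left
      (rpow_add_one_sub_le hβ (hX01 f hf.1 a).1 (hX01 g hg a).1) (hl a).le
    linarith
  have hdiff := abs_le.1 (hclose f hf.1 (fun a => X f a - X g a) fun a => by
    have h1 := hX01 f hf.1 a
    have h2 := hX01 g hg a
    exact abs_le.2 ⟨by linarith [h1.1, h2.2], by linarith [h1.2, h2.1]⟩)
  have hcf := abs_le.1 (hcloseX f hf.1)
  have hcg := abs_le.1 (hcloseX g hg)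
  have hmain : (β + 1) * ∑ a, l a * X f a ^ β * (X f a - X g a) ≤ (β + 1) * (n * w) :=
    mul_le_mul_of_nonneg_left (by linarith [hdiff.1]) (by linarith)
  have hle : ∑ a, Z f a * X f a ≤ ∑ a, Z g a * X g a + (β + 3) * (n * w) := by
    linarith [hcf.2, hcg.1]
  have hfac : (β + 3) * (n * w) ≤ 2 * (β + 3) * n / κ * w * ∑ a, Z g a * X g a := by
    calc (β + 3) * (n * w) = 2 * (β + 3) * n / κ * w * (κ / 2) := by field_simp
      _ ≤ _ := mul_le_mul_of_nonneg_left (hpos g hg) (by positivity)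
  rw [hcost, hcost]
  calc T * c * ∑ a, Z f a * X f a
      ≤ T * c * ((1 + 2 * (β + 3) * n / κ * w) * ∑ a, Z g a * X g a) := by
        refine mul_le_mul_of_nonneg_left ?_ (by positivity)
        linarith
    _ = _ := by ring

end CongestionGame

/-! ### Uniform convergence and the deviation bound -/

/-- Pólya's theorem on `[0, 1]`: monotone functions converging pointwise to a continuous function
on a dense set converge uniformly; here the limit is a multiple of a power function. -/
lemma eventually_forall_abs_sub_mul_rpow_le {h : ℝ → ℝ → ℝ} {β l ε : ℝ} (hβ : 0 < β)
    (hε : 0 < ε)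
    (hmono : ∀ᶠ T in atTop, MonotoneOn (h T) (Set.Icc 0 1))
    (hnn : ∀ᶠ T in atTop, 0 ≤ h T 0)
    (hlim : ∀ x, 0 < x → Tendsto (fun T => h T x) atTop (𝓝 (l * x ^ β))) :
    ∀ᶠ T in atTop, ∀ x ∈ Set.Icc (0 : ℝ) 1, |h T x - l * x ^ β| ≤ ε := by
  have hcont : ContinuousOn (fun x : ℝ => l * x ^ β) (Set.Icc 0 1) :=
    (continuous_const.mul (Real.continuous_rpow_const hβ.le)).continuousOn
  obtain ⟨δ, hδ, huc⟩ := Metric.uniformContinuousOn_iff.1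
    (isCompact_Icc.uniformContinuousOn_of_continuous hcont) (ε / 2) (by positivity)
  obtain ⟨N, hN⟩ := exists_nat_one_div_lt hδ
  have hN0 : (0 : ℝ) < N + 1 := by positivity
  have hev : ∀ᶠ T in atTop, ∀ i ∈ Finset.range (N + 1),
      |h T ((i + 1 : ℕ) / (N + 1 : ℝ)) - l * ((i + 1 : ℕ) / (N + 1 : ℝ)) ^ β| < ε / 2 := by
    refine (Filter.eventually_all_finset _).2 fun i _ => ?_
    have := hlim ((i + 1 : ℕ) / (N + 1 : ℝ)) (by positivity)
    exact (Metric.tendsto_nhds.1 this) (ε / 2) (by positivity)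
  filter_upwards [hev, hmono, hnn] with T hT hm h0 x hx
  -- `x` lies between two consecutive grid points `i / (N + 1)` and `(i + 1) / (N + 1)`
  obtain ⟨i, hi, hlo, hup⟩ : ∃ i ≤ N, (i : ℝ) / (N + 1) ≤ x ∧ x ≤ ((i + 1 : ℕ) : ℝ) / (N + 1) := by
    -- At `x = 1` the floor would be `N + 1`, one cell too far.
    rcases hx.2.eq_or_lt with rfl | hx1
    · exact ⟨N, le_rfl, (div_le_one hN0).2 (by linarith), (one_le_div hN0).2 (by push_cast; rfl)⟩
    · have hnn : 0 ≤ x * (N + 1) := mul_nonneg hx.1 hN0.le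
      refine ⟨⌊x * (N + 1)⌋₊, Nat.lt_succ_iff.1 ((Nat.floor_lt hnn).2 ?_), ?_, ?_⟩
      · push_cast
        nlinarith
      · exact (div_le_iff₀ hN0).2 (Nat.floor_le hnn)
      · rw [le_div_iff₀ hN0]
        push_cast
        exact (Nat.lt_floor_add_one _).le
  have hiN : (i : ℝ) ≤ N := by exact_mod_cast hi
  have hu1 : ((i + 1 : ℕ) : ℝ) / (N + 1) ≤ 1 := (div_le_one hN0).2 (by push_cast; linarith)
  have hu : ((i + 1 : ℕ) : ℝ) / (N + 1) ∈ Set.Icc (0 : ℝ) 1 := ⟨by positivity, hu1⟩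
  have hlI : (i : ℝ) / (N + 1) ∈ Set.Icc (0 : ℝ) 1 := ⟨by positivity, hlo.trans hx.2⟩
  have hgap : ((i + 1 : ℕ) : ℝ) / (N + 1) - i / (N + 1) = 1 / (N + 1) := by
    push_cast
    ring
  have hcu := abs_lt.1 (huc _ hu x hx (by
    rw [Real.dist_eq, abs_of_nonneg (by linarith)]; linarith))
  have hcl := abs_lt.1 (huc x hx _ hlI (by
    rw [Real.dist_eq, abs_of_nonneg (by linarith)]; linarith))
  have hup' := abs_lt.1 (hT i (Finset.mem_range.2 (by omega)))
  -- Convergence is known only at positive grid points; at `0` the limit vanishes and non-negativity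
  -- suffices.
  have hlow : l * (i / (N + 1 : ℝ)) ^ β - ε / 2 ≤ h T (i / (N + 1)) := by
    rcases i with _ | j
    · simp only [Nat.cast_zero, zero_div, Real.zero_rpow hβ.ne', mul_zero]
      linarith
    · linarith [(abs_lt.1 (hT j (Finset.mem_range.2 (by omega)))).1]
  have hm1 := hm hlI hx hlo
  have hm2 := hm hx hu hup
  exact abs_le.2 ⟨by linarith [hcl.2], by linarith [hcu.2, hup'.2]⟩

section

variable {A : Type*} {τ : A → ℝ → ℝ} {β : ℝ} {lam : A → A → ℝ} {b : A}

lemma deviationBound_nonneg (T : ℝ) : 0 ≤ deviationBound τ lam β b T :=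
  Real.iSup_nonneg fun _ => abs_nonneg _

lemma le_deviationBound [Finite A] (hβ : 0 < β) {T : ℝ} (hT : 0 ≤ T)
    (hτ : ∀ a, IsCostFunction (τ a)) (a : A) {x : ℝ} (hx : x ∈ Set.Icc (0 : ℝ) 1) :
    |τ a (T * x) / τ b T - lam a b * x ^ β| ≤ deviationBound τ lam β b T := by
  refine le_ciSup (f := fun p : A × Set.Icc (0 : ℝ) 1 =>
    |τ p.1 (T * (p.2 : ℝ)) / τ b T - lam p.1 b * (p.2 : ℝ) ^ β|) ?_ (a, ⟨x, hx⟩)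
  -- Boundedness is needed for the supremum to dominate its terms; by monotonicity the value at `x =
  -- 1` controls each quotient.
  obtain ⟨M, hM⟩ := (Set.finite_range fun a => τ a T / τ b T + |lam a b|).bddAbove
  refine ⟨M, ?_⟩
  rintro _ ⟨⟨a, x, hx0, hx1⟩, rfl⟩
  refine le_trans ?_ (hM ⟨a, rfl⟩)
  dsimp only
  have hb : 0 ≤ τ b T := (hτ b).nonneg T hT
  have hTx : 0 ≤ T * x := mul_nonneg hT hx0
  refine (abs_sub _ _).trans (add_le_add ?_ ?_)
  · rw [abs_of_nonneg (div_nonneg ((hτ a).nonneg _ hTx) hb)]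
    exact div_le_div_of_nonneg_right
      ((hτ a).monotoneOn hTx hT (mul_le_of_le_one_right hT hx1)) hb
  · rw [abs_mul, abs_of_nonneg (Real.rpow_nonneg hx0 β)]
    exact mul_le_of_le_one_right (abs_nonneg _) (Real.rpow_le_one hx0 hx1 hβ.le)

lemma tendsto_deviationBound [Finite A] (hβ : 0 < β) (hτ : ∀ a, IsCostFunction (τ a))
    (hreg : ∀ a, RegularlyVarying (τ a) β)
    (hlim : ∀ a b, Tendsto (fun T => τ a T / τ b T) atTop (𝓝 (lam a b))) (b : A) :
    Tendsto (deviationBound τ lam β b) atTop (𝓝 0) := by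
  rw [Metric.tendsto_nhds]
  intro ε hε
  have hev : ∀ᶠ T in atTop, ∀ a, ∀ x ∈ Set.Icc (0 : ℝ) 1,
      |τ a (T * x) / τ b T - lam a b * x ^ β| ≤ ε / 2 := by
    refine Filter.eventually_all.2 fun a => ?_
    refine eventually_forall_abs_sub_mul_rpow_le (h := fun T x => τ a (T * x) / τ b T) hβ
      (by positivity) ?_ ?_ fun x hx => ?_
    · filter_upwards [eventually_ge_atTop 0] with T hT x hx y hy hxy
      exact div_le_div_of_nonneg_right ((hτ a).monotoneOn (mul_nonneg hT hx.1)
        (mul_nonneg hT hy.1) (mul_le_mul_of_nonneg_left hxy hT)) ((hτ b).nonneg T hT)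
    · filter_upwards [eventually_ge_atTop 0] with T hT
      exact div_nonneg ((hτ a).nonneg _ (by simp)) ((hτ b).nonneg T hT)
    -- The quotient factors as `τ a (T * x) / τ a T` times `τ a T / τ b T`.
    · rw [mul_comm]
      refine (((hreg a).tendsto x hx).mul (hlim a b)).congr' ?_
      obtain ⟨X, hX, -⟩ := (hreg a).eventually_pos_measurable
      filter_upwards [eventually_ge_atTop X] with T hT
      exact div_mul_div_cancel₀ (hX T hT).ne'
  filter_upwards [hev] with T hT
  rw [dist_zero_right, Real.norm_of_nonneg (deviationBound_nonneg T)]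
  refine lt_of_le_of_lt ?_ (half_lt_self hε)
  exact Real.iSup_le (fun p => hT p.1 _ p.2.2) (by positivity)

end

/-! ### Logarithmic costs -/

/-- `ln ^ α (x + 1)` is slowly varying, with remainder `O(1 / ln T)` against any power. -/
lemma abs_rpow_mul_log_rpow_div_sub_le {β α : ℝ} (hβ : 0 < β) (hα : 0 ≤ α) {T x : ℝ} (hT : 0 < T)
    (hx : x ∈ Set.Icc (0 : ℝ) 1) :
    |(T * x) ^ β * Real.log (T * x + 1) ^ α / (T ^ β * Real.log (T + 1) ^ α) - x ^ β|
      ≤ (1 + α) / β / Real.log (T + 1) := by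
  have hL : 0 < Real.log (T + 1) := Real.log_pos (by linarith)
  rcases hx.1.eq_or_lt with rfl | hx0
  · simp only [mul_zero, Real.zero_rpow hβ.ne', zero_mul, zero_div, sub_zero, abs_zero]
    positivity
  have hTx : 0 < T * x := mul_pos hT hx0
  -- The error equals `x ^ β * (1 - r ^ α)`. Since `1 - r` is at most `|ln x| / ln (T + 1)`, the
  -- factor `x ^ β` absorbs the singularity at `0`.
  set r : ℝ := Real.log (T * x + 1) / Real.log (T + 1) with hr
  have hr0 : 0 ≤ r := div_nonneg (Real.log_nonneg (by linarith)) hL.le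
  have hr1 : r ≤ 1 := (div_le_one hL).2 (Real.log_le_log (by linarith)
    (by linarith [mul_le_of_le_one_right hT.le hx.2]))
  have hrlow : 1 - r ≤ |Real.log x| / Real.log (T + 1) := by
    rw [abs_of_nonpos (Real.log_nonpos hx0.le hx.2), hr, one_sub_div hL.ne']
    refine div_le_div_of_nonneg_right ?_ hL.le
    have h1 : Real.log (x * (T + 1)) ≤ Real.log (T * x + 1) :=
      Real.log_le_log (by positivity) (by nlinarith [hx.2])
    rw [Real.log_mul hx0.ne' (by linarith)] at h1
    linarith
  -- The factor `1 + α` serves both ranges: `r ≤ r ^ α` for `α ≤ 1`, Bernoulli for `α ≥ 1`.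
  have hpow : 1 - r ^ α ≤ (1 + α) * (1 - r) := by
    rcases le_total α 1 with h | h
    · have := Real.rpow_le_rpow_of_exponent_ge' hr0 hr1 hα h
      rw [Real.rpow_one] at this
      nlinarith [mul_nonneg hα (sub_nonneg.2 hr1)]
    · have := one_add_mul_self_le_rpow_one_add (s := r - 1) (by linarith) h
      rw [add_sub_cancel] at this
      nlinarith
  have heq : (T * x) ^ β * Real.log (T * x + 1) ^ α / (T ^ β * Real.log (T + 1) ^ α) - x ^ β
      = -(x ^ β * (1 - r ^ α)) := by
    rw [hr, Real.div_rpow (Real.log_nonneg (by linarith)) hL.le, Real.mul_rpow hT.le hx0.le]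
    have := (Real.rpow_pos_of_pos hT β).ne'
    have := (Real.rpow_pos_of_pos hL α).ne'
    field_simp
    ring
  have hxβ : 0 ≤ x ^ β := Real.rpow_nonneg hx0.le β
  rw [heq, abs_neg, abs_of_nonneg
    (mul_nonneg hxβ (sub_nonneg.2 (Real.rpow_le_one hr0 hr1 hα)))]
  have hlog : |Real.log x| * x ^ β ≤ 1 / β := by
    have := (Real.abs_log_mul_self_rpow_lt x β hx0 hx.2 hβ).le
    rwa [abs_mul, abs_of_nonneg hxβ] at this
  calc x ^ β * (1 - r ^ α) ≤ x ^ β * ((1 + α) * (|Real.log x| / Real.log (T + 1))) := by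
        gcongr
        exact hpow.trans (mul_le_mul_of_nonneg_left hrlow (by linarith))
    _ = (1 + α) / Real.log (T + 1) * (|Real.log x| * x ^ β) := by ring
    _ ≤ (1 + α) / Real.log (T + 1) * (1 / β) := by gcongr
    _ = _ := by ring

/-! ### The two asymptotic bounds -/

lemma le_sqrt_of_le_one {w : ℝ} (h0 : 0 ≤ w) (h1 : w ≤ 1) : w ≤ √w :=
  Real.le_sqrt_of_sq_le (by nlinarith)

theorem corollary2 {A K : Type*} [Fintype A] [DecidableEq A] [Fintype K] [Nonempty K]
    (S : CongestionStructure A K) :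
    (∀ (τ : A → ℝ → ℝ) (β : ℝ) (lam : A → A → ℝ),
      0 < β →
      (∀ a, IsCostFunction (τ a)) →
      (∀ a, RegularlyVarying (τ a) β) →
      (∀ a b, 0 < lam a b) →
      (∀ a b, Tendsto (fun T => τ a T / τ b T) atTop (𝓝 (lam a b))) →
      BehavesWellForGrowingDemands S τ ∧
      ∀ b : A,
        Tendsto (deviationBound τ lam β b) atTop (𝓝 0) ∧
        ∃ C > 0, ∃ T₀ > 0, ∀ Γ ∈ costSlice S τ, T₀ ≤ Γ.totalDemand →
          |Γ.priceOfAnarchy - 1| ≤ C * √(deviationBound τ lam β b Γ.totalDemand)) ∧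
    (∀ (β α : ℝ) (ζ : A → ℝ),
      0 < β → 0 ≤ α → (∀ a, 0 < ζ a) →
      ∃ C > 0, ∃ T₀ > 0,
        ∀ Γ ∈ costSlice S (fun a x => ζ a * x ^ β * Real.log (x + 1) ^ α),
          T₀ ≤ Γ.totalDemand →
          |Γ.priceOfAnarchy - 1| ≤ C * √(1 / Real.log (Γ.totalDemand + 1))) := by
  have hA : Nonempty A := by
    obtain ⟨k⟩ := ‹Nonempty K›
    obtain ⟨s, hs⟩ := S.strategies_nonempty k
    obtain ⟨a, -⟩ := S.nonempty_of_mem k s hs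
    exact ⟨a⟩
  refine ⟨fun τ β lam hβ hτ hreg hlam hlim => ?_, fun β α ζ hβ hα hζ => ?_⟩
  · have hbound : ∀ b : A, ∃ C > 0, ∃ T₀ > 0, ∀ Γ ∈ costSlice S τ, T₀ ≤ Γ.totalDemand →
        |Γ.priceOfAnarchy - 1| ≤ C * √(deviationBound τ lam β b Γ.totalDemand) := by
      intro b
      obtain ⟨C, hC, w₀, hw₀, h⟩ :=
        CongestionGame.exists_abs_priceOfAnarchy_sub_one_le S hβ fun a => hlam a b
      -- Beyond `T₁` the deviation is at most `w₀`, for the comparison, and at most `1`, for `w ≤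
      -- √w`.
      obtain ⟨T₁, hT₁⟩ := eventually_atTop.1
        ((tendsto_deviationBound hβ hτ hreg hlim b).eventually_le_const
          (lt_min hw₀ one_pos))
      refine ⟨C, hC, max T₁ 1, by positivity, fun Γ hΓ hT => ?_⟩
      have hT0 : 0 < Γ.totalDemand := Γ.total_pos
      have hw := hT₁ _ ((le_max_left _ _).trans hT)
      have hc : 0 < τ b Γ.totalDemand := by
        rw [← hΓ b _ ⟨hT0.le, le_rfl⟩]
        exact Γ.cost_pos b _ hT0 le_rfl
      refine (h Γ _ _ hc (hw.trans (min_le_left _ _)) fun a x hx => ?_).trans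
        (mul_le_mul_of_nonneg_left (le_sqrt_of_le_one (deviationBound_nonneg _)
          (hw.trans (min_le_right _ _))) hC.le)
      rw [hΓ a _ ⟨mul_nonneg hT0.le hx.1, mul_le_of_le_one_right hT0.le hx.2⟩]
      exact le_deviationBound hβ hT0.le hτ a hx
    refine ⟨fun Γ hΓ hT => ?_,
      fun b => ⟨tendsto_deviationBound hβ hτ hreg hlim b, hbound b⟩⟩
    obtain ⟨b⟩ := hA
    obtain ⟨C, -, T₀, -, h⟩ := hbound b
    rw [tendsto_iff_dist_tendsto_zero]
    refine squeeze_zero' (Eventually.of_forall fun _ => dist_nonneg)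
      (g := fun n => C * √(deviationBound τ lam β b (Γ n).totalDemand)) ?_ ?_
    · filter_upwards [hT.eventually_ge_atTop T₀] with n hn
      exact h (Γ n) (hΓ n) hn
    · simpa using ((tendsto_deviationBound hβ hτ hreg hlim b).comp hT).sqrt.const_mul C
  · obtain ⟨C, hC, w₀, hw₀, h⟩ :=
      CongestionGame.exists_abs_priceOfAnarchy_sub_one_le S hβ hζ
    obtain ⟨a₀, hmax⟩ := Finite.exists_max ζ
    set M : ℝ := ζ a₀ * ((1 + α) / β) with hM
    have hM0 : 0 < M := by have := hζ a₀; positivity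
    have hlog : Tendsto (fun T : ℝ => Real.log (T + 1)) atTop atTop :=
      Real.tendsto_log_atTop.comp (tendsto_atTop_add_const_right _ _ tendsto_id)
    obtain ⟨T₁, hT₁⟩ := eventually_atTop.1 (hlog.eventually_ge_atTop (max 1 (M / w₀)))
    refine ⟨C * M, by positivity, max T₁ 1, by positivity, fun Γ hΓ hT => ?_⟩
    set T := Γ.totalDemand with hTdef
    have hT0 : 0 < T := Γ.total_pos
    have hL := hT₁ T ((le_max_left _ _).trans hT)
    have hL1 : 1 ≤ Real.log (T + 1) := (le_max_left _ _).trans hL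
    have hLpos : 0 < Real.log (T + 1) := by linarith
    have hw : M / Real.log (T + 1) ≤ w₀ := by
      rw [div_le_iff₀ hLpos, mul_comm, ← div_le_iff₀ hw₀]
      exact (le_max_right _ _).trans hL
    -- This normalizer omits the coefficients, so the limit monomials have weights `ζ a`.
    have hc : 0 < T ^ β * Real.log (T + 1) ^ α := by positivity
    refine (h Γ _ _ hc hw fun a x hx => ?_).trans ?_
    · rw [hΓ a _ ⟨mul_nonneg hT0.le hx.1, mul_le_of_le_one_right hT0.le hx.2⟩]
      dsimp only
      rw [mul_assoc, mul_div_assoc, ← mul_sub, abs_mul, abs_of_pos (hζ a)]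
      refine (mul_le_mul (hmax a) (abs_rpow_mul_log_rpow_div_sub_le hβ hα hT0 hx)
        (abs_nonneg _) (hζ a₀).le).trans_eq ?_
      rw [hM]
      ring
    · have := le_sqrt_of_le_one (w := 1 / Real.log (T + 1)) (by positivity)
        ((div_le_one hLpos).2 hL1)
      calc C * (M / Real.log (T + 1)) = C * M * (1 / Real.log (T + 1)) := by ring
        _ ≤ _ := mul_le_mul_of_nonneg_left this (by positivity)
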